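/- Conventions. Write $z_j=x_j+iy_j$ on $\mathbb C^n$, and for a smooth real function $f$ on an open subset of $\mathbb C^n$ put $$d^cf=\sum_{j=1}^n\Big(\frac{\partial f}{\partial x_j}\,dy_j-\frac{\partial f}{\partial y_j}\,dx_j\Big),\qquad dd^cf=d(d^cf);$$ $dd^cf>0$ on $U$ means that at each point of $U$ the $(1,1)$-form $dd^cf$ is strictly positive, i.e. $(dd^cf)(v,iv)>0$ for all $v\in\mathbb C^n\setminus\{0\}$. Let $M$ be a smooth manifold of real dimension $n$. A smooth immersion $\iota:M\to\mathbb C^n$ is totally real if for every $z\in M$ the real subspace $\iota_*(T_zM)\subset\mathbb C^n$ contains no complex line. A point $p\in\iota(M)$ is called an isolated transverse double point of $\iota(M)$ if there are distinct points $z,w\in M$ with $\iota(z)=\iota(w)=p$ such that $\iota_*(T_zM)\oplus\iota_*(T_wM)=\mathbb C^n$ and such that near $p$ the set $\iota(M)$ consists of the two local branches of $\iota$ at $z$ and $w$: for all neighborhoods $V$ of $z$ and $W$ of $w$ in $M$ there is a neighborhood $N$ of $p$ with $\iota(M)\cap N\subset\iota(V)\cup\iota(W)$ (this is automatic if $M$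 is compact and $\iota^{-1}(p)=\{z,w\}$). It is called diagonalizable if, for such $z,w$, there are a nonsingular complex linear map $G:\mathbb C^n\to\mathbb C^n$ and a real $n\times n$ matrix $A$, diagonalizable over $\mathbb R$, with $G(\iota_*(T_zM))=\mathbb R^n$ and $G(\iota_*(T_wM))=(A+i)\mathbb R^n=\{Ax+ix:x\in\mathbb R^n\}$. Lemma. Let $\iota:M\to\mathbb C^n$ be a smooth totally real immersion of a smooth $n$-dimensional manifold $M$, and let $p\in\iota(M)$ be an isolated diagonalizable transverse double point of $\iota(M)$. Then there exist an open neighborhood $U$ of $p$ in $\mathbb C^n$ and a smooth function $f:U\to\mathbb R$ such that (i) $\iota^*(d^cf)=0$ on $\iota^{-1}(U)$, and (ii) $dd^cf>0$ on $U$. -/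

import Mathlib

open Topology
open scoped Manifold ContDiff

noncomputable section

/-- Complex Euclidean `n`-space `ℂⁿ`. -/
abbrev Cn (n : ℕ) : Type := EuclideanSpace ℂ (Fin n)

/-- The real-linear functional `dx_j` on `ℂⁿ`, where `z_j = x_j + i y_j`. -/
def dxForm {n : ℕ} (j : Fin n) : Cn n →L[ℝ] ℝ :=
  Complex.reCLM.comp ((EuclideanSpace.proj j : Cn n →L[ℂ] ℂ).restrictScalars ℝ)

/-- The real-linear functional `dy_j` on `ℂⁿ`, where `z_j = x_j + i y_j`. -/
def dyForm {n : ℕ} (j : Fin n) : Cn n →L[ℝ] ℝ :=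
  Complex.imCLM.comp ((EuclideanSpace.proj j : Cn n →L[ℂ] ℂ).restrictScalars ℝ)

/-- The real partial derivative `∂f/∂x_j`. -/
def partialX {n : ℕ} (f : Cn n → ℝ) (j : Fin n) (z : Cn n) : ℝ :=
  fderiv ℝ f z (EuclideanSpace.single j (1 : ℂ))

/-- The real partial derivative `∂f/∂y_j`. -/
def partialY {n : ℕ} (f : Cn n → ℝ) (j : Fin n) (z : Cn n) : ℝ :=
  fderiv ℝ f z (EuclideanSpace.single j Complex.I)

/-- The one-form `dᶜf = ∑ⱼ (∂f/∂x_j dy_j - ∂f/∂y_j dx_j)`. -/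
def dc {n : ℕ} (f : Cn n → ℝ) (z : Cn n) : Cn n →L[ℝ] ℝ :=
  ∑ j, (partialX f j z • dyForm j - partialY f j z • dxForm j)

/-- The two-form `ddᶜf`, the exterior derivative of `dᶜf`. -/
def ddc {n : ℕ} (f : Cn n → ℝ) (z : Cn n) : Cn n [⋀^Fin 2]→L[ℝ] ℝ :=
  extDeriv (fun ζ => ContinuousAlternatingMap.ofSubsingleton ℝ (Cn n) ℝ (0 : Fin 1) (dc f ζ)) z

/-- Strict positivity of a `(1,1)`-form at a point: `θ(v, iv) > 0` for every `v ≠ 0`. -/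
def IsPositiveForm {n : ℕ} (θ : Cn n [⋀^Fin 2]→L[ℝ] ℝ) : Prop :=
  ∀ v : Cn n, v ≠ 0 → 0 < θ ![v, Complex.I • v]

/-- The plane `ℝⁿ ⊂ ℂⁿ`. -/
def realPlane (n : ℕ) : Set (Cn n) := {ζ | ∀ j, (ζ j).im = 0}

/-- The plane `S(A) = (A + i)ℝⁿ ⊂ ℂⁿ`. -/
def graphPlane {n : ℕ} (A : Matrix (Fin n) (Fin n) ℝ) : Set (Cn n) :=
  {ζ | ∃ x : Fin n → ℝ, ∀ j, (ζ j).re = (A.mulVec x) j ∧ (ζ j).im = x j}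

/-- Diagonalizability over the reals. -/
def IsRealDiagonalizable {n : ℕ} (A : Matrix (Fin n) (Fin n) ℝ) : Prop :=
  ∃ (P : Matrix (Fin n) (Fin n) ℝ) (d : Fin n → ℝ),
    IsUnit P ∧ A = P * Matrix.diagonal d * P⁻¹

section Immersions

variable {n : ℕ} {M : Type*} [TopologicalSpace M] [ChartedSpace (EuclideanSpace ℝ (Fin n)) M]

/-- The differential `ι_* : T_zM → ℂⁿ`. -/
def pushforward (ι : M → Cn n) (z : M) : TangentSpace (𝓡 n) z →L[ℝ] Cn n :=
  mfderiv (𝓡 n) 𝓘(ℝ, Cn n) ι z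

/-- The real subspace `ι_*(T_zM)` of `ℂⁿ`. -/
def tangentPlane (ι : M → Cn n) (z : M) : Submodule ℝ (Cn n) :=
  LinearMap.range (pushforward ι z).toLinearMap

/-- A map `ι` is totally real if no `ι_*(T_zM)` contains a complex line. -/
def IsTotallyReal (ι : M → Cn n) : Prop :=
  ∀ z : M, ∀ v ∈ tangentPlane ι z, Complex.I • v ∈ tangentPlane ι z → v = 0

/-- `p` is an isolated transverse double point of `ι(M)`, with preimages `z` and `w` on the
two branches: near `p` the set `ι(M)` is made up of the two local branches of `ι` at
`z` and at `w` only, and these branches are transverse at `p`. If `M` is compact Hausdorff and `ι`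
is continuous, `branches` holds as soon as `ι⁻¹(p) = {z, w}`. -/
structure IsIsolatedTransverseDoublePoint (ι : M → Cn n) (p : Cn n) (z w : M) : Prop where
  ne : z ≠ w
  map_left : ι z = p
  map_right : ι w = p
  branches : ∀ V ∈ 𝓝 z, ∀ W ∈ 𝓝 w, ∃ U ∈ 𝓝 p, Set.range ι ∩ U ⊆ ι '' V ∪ ι '' W
  transverse : IsCompl (tangentPlane ι z) (tangentPlane ι w)

/-- `p` is an isolated diagonalizable (transverse) double point of `ι(M)`: some nonsingular complex
linear map `G` sends the two tangent planes at `p` to `ℝⁿ` and `(A + i)ℝⁿ`, with `A` a real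
matrix that is diagonalizable over the reals. -/
def IsIsolatedDiagonalizableDoublePoint (ι : M → Cn n) (p : Cn n) : Prop :=
  ∃ z w : M, IsIsolatedTransverseDoublePoint ι p z w ∧
    ∃ (G : Cn n ≃ₗ[ℂ] Cn n) (A : Matrix (Fin n) (Fin n) ℝ),
      G '' (tangentPlane ι z : Set (Cn n)) = realPlane n ∧
      G '' (tangentPlane ι w : Set (Cn n)) = graphPlane A ∧
      IsRealDiagonalizable A

/-- The pull-back `ι^*α` at `z` of a one-form `α` on (a part of) `ℂⁿ`. -/
def pullback (ι : M → Cn n) (α : Cn n → (Cn n →L[ℝ] ℝ)) (z : M) :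
    TangentSpace (𝓡 n) z →L[ℝ] ℝ :=
  (α (ι z)).comp (pushforward ι z)

end Immersions

end

/-! Since `A` is diagonalizable over ℝ, some Hermitian metric, with real part `B`, makes both
tangent planes at `p` Lagrangian (`exists_lagrangian_form`). For flat branches `Q(ζ) = B(ζ - p, ζ -
p)` would already do: its Hessian is positive definite, and `dᶜQ` vanishes along both planes. For
curved branches `dᶜQ` restricted to each branch only vanishes to second order at `p`, and this error
has to be removed without disturbing the Hessian at `p`.

In coordinates `(x, y)` in which the branches are `y = 0` and `x = 0`, take `f = Q + b₁(x)y +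
b₂(y)x`. Along `y = 0` the first correction has differential `b₁(x)dy`. The tangent plane of the
branch at `p` is totally real, being Lagrangian, so near `p` the vectors `J·tangent` are determined
by their `dy`-components, and `b₁` can be solved for (`exists_normal_correction`). The second-order
vanishing of the error gives `b₁` a zero 1-jet, so `b₁(x)y` has zero 2-jet at `p`
(`contDiffOn_fderiv_pairing`); likewise for `b₂`. Each correction has zero differential along the
other branch, and the Hessian of `f` at `p` is still `2B`. Finally `ddᶜf(v, iv)` is the sum of the
Hessian values at `v` and `iv`. -/

section LocalAnalysis

/-! ### Local diffeomorphisms and the correction terms. -/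

variable {E E' F : Type*} [NormedAddCommGroup E] [NormedSpace ℝ E]
  [NormedAddCommGroup E'] [NormedSpace ℝ E'] [NormedAddCommGroup F] [NormedSpace ℝ F]

theorem ContDiffOn.hasFDerivAt_fderiv {f : E → F} {s : Set E} (hf : ContDiffOn ℝ ∞ f s)
    (hs : IsOpen s) {x : E} (hx : x ∈ s) : HasFDerivAt f (fderiv ℝ f x) x :=
  ((hf.contDiffAt (hs.mem_nhds hx)).differentiableAt (by simp)).hasFDerivAt

/-- The smooth inverse function theorem, with a local inverse that is smooth on its whole domain. -/
theorem exists_openPartialHomeomorph_contDiffOn [CompleteSpace E'] {ψ : E' → F} {O : Set E'}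
    (hO : IsOpen O) (hψ : ContDiffOn ℝ ∞ ψ O) {a : E'} (ha : a ∈ O)
    (hbij : Function.Bijective (fderiv ℝ ψ a)) [CompleteSpace F] :
    ∃ Ψ : OpenPartialHomeomorph E' F, ⇑Ψ = ψ ∧ a ∈ Ψ.source ∧
      ContDiffOn ℝ ∞ Ψ Ψ.source ∧ ContDiffOn ℝ ∞ Ψ.symm Ψ.target := by
  have hat : ∀ x ∈ O, ContDiffAt ℝ ∞ ψ x := fun x hx => hψ.contDiffAt (hO.mem_nhds hx)
  let e : E' ≃L[ℝ] F := ContinuousLinearEquiv.ofBijective (fderiv ℝ ψ a)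
    (LinearMap.ker_eq_bot.2 hbij.1) (LinearMap.range_eq_top.2 hbij.2)
  have he : HasFDerivAt ψ (e : E' →L[ℝ] F) a := by
    have := ((hat a ha).differentiableAt (by simp)).hasFDerivAt
    convert this using 1
    ext v
    rfl
  -- Invertibility of the derivative is an open condition; on `S` the inverse is smooth at every
  -- point, not just at `ψ a`.
  let S : Set E' := O ∩ fderiv ℝ ψ ⁻¹' (Set.range ((↑) : (E' ≃L[ℝ] F) → E' →L[ℝ] F))
  have hS : IsOpen S :=
    (hψ.continuousOn_fderiv_of_isOpen hO (by simp)).isOpen_inter_preimage hO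
      ContinuousLinearEquiv.isOpen
  let Ψ := ((hat a ha).toOpenPartialHomeomorph ψ he (by simp)).restrOpen S hS
  have hsrc : Ψ.source ⊆ S := fun x hx => by
    simp only [Ψ, OpenPartialHomeomorph.restrOpen_source] at hx
    exact hx.2
  refine ⟨Ψ, rfl, ?_, ?_, ?_⟩
  · simp only [Ψ, OpenPartialHomeomorph.restrOpen_source]
    exact ⟨(hat a ha).mem_toOpenPartialHomeomorph_source he (by simp), ha, e, he.fderiv.symm⟩
  · exact hψ.mono fun x hx => (hsrc hx).1
  · intro y hy
    have hs := hsrc (Ψ.map_target hy)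
    obtain ⟨e', he'⟩ := hs.2
    refine (Ψ.contDiffAt_symm (f₀' := e') hy ?_ (hat _ hs.1)).contDiffWithinAt
    rw [he']
    exact ((hat _ hs.1).differentiableAt (by simp)).hasFDerivAt

theorem fderiv_symm_comp_fderiv {Ψ : OpenPartialHomeomorph E' F}
    (hΨ : ContDiffOn ℝ ∞ Ψ Ψ.source) (hΨs : ContDiffOn ℝ ∞ Ψ.symm Ψ.target)
    {x : E'} (hx : x ∈ Ψ.source) :
    (fderiv ℝ Ψ.symm (Ψ x)).comp (fderiv ℝ Ψ x) = .id ℝ E' := by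
  have h1 := hΨ.hasFDerivAt_fderiv Ψ.open_source hx
  have h2 := hΨs.hasFDerivAt_fderiv Ψ.open_target (Ψ.map_source hx)
  refine (h2.comp x h1).unique ((hasFDerivAt_id x).congr_of_eventuallyEq ?_)
  filter_upwards [Ψ.open_source.mem_nhds hx] with y hy
  simp [hy]

theorem fderiv_comp_fderiv_symm {Ψ : OpenPartialHomeomorph E' F}
    (hΨ : ContDiffOn ℝ ∞ Ψ Ψ.source) (hΨs : ContDiffOn ℝ ∞ Ψ.symm Ψ.target)
    {x : E'} (hx : x ∈ Ψ.source) :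
    (fderiv ℝ Ψ x).comp (fderiv ℝ Ψ.symm (Ψ x)) = .id ℝ F := by
  have h1 := hΨ.hasFDerivAt_fderiv Ψ.open_source hx
  have h2 := hΨs.hasFDerivAt_fderiv Ψ.open_target (Ψ.map_source hx)
  have h3 : HasFDerivAt Ψ (fderiv ℝ Ψ x) (Ψ.symm (Ψ x)) := by rwa [Ψ.left_inv hx]
  refine (h3.comp _ h2).unique ((hasFDerivAt_id _).congr_of_eventuallyEq ?_)
  filter_upwards [Ψ.open_target.mem_nhds (Ψ.map_source hx)] with y hy
  simp [hy]

/-- Along the image of the subspace `i E` under a local diffeomorphism `Ψ`, whose tangent plane at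
`Ψ 0` is isotropic for `B(·, J·)`, there is a normal covector field `b` with vanishing `1`-jet at
the origin that cancels the derivative of `ζ ↦ B(ζ - Ψ 0, ζ - Ψ 0)` in the `J`-tangential
directions. -/
theorem exists_normal_correction [FiniteDimensional ℝ E] {Ψ : OpenPartialHomeomorph E' F}
    (hΨ : ContDiffOn ℝ ∞ Ψ Ψ.source) (hΨs : ContDiffOn ℝ ∞ Ψ.symm Ψ.target)
    (h0 : (0 : E') ∈ Ψ.source)
    (i : E →L[ℝ] E') (q : E' →L[ℝ] E) (hi : Function.Injective i)
    (hq : ∀ w, q w = 0 → ∃ s, w = i s) (J : F →L[ℝ] F) (hJ : Function.Injective J)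
    (B : F →L[ℝ] F →L[ℝ] ℝ) (hpos : ∀ v, B v v = 0 → v = 0)
    (hL : ∀ u u', B (fderiv ℝ Ψ 0 (i u)) (J (fderiv ℝ Ψ 0 (i u'))) = 0) :
    ∃ (O : Set E) (b : E → E →L[ℝ] ℝ), IsOpen O ∧ 0 ∈ O ∧ ContDiffOn ℝ ∞ b O ∧
      b 0 = 0 ∧ fderiv ℝ b 0 = 0 ∧ ∀ x ∈ O, ∀ u,
        2 * B (Ψ (i x) - Ψ 0) (J (fderiv ℝ Ψ (i x) (i u))) +
          b x (q (fderiv ℝ Ψ.symm (Ψ (i x)) (J (fderiv ℝ Ψ (i x) (i u))))) = 0 := by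
  let S : Set E := i ⁻¹' Ψ.source
  have hS : IsOpen S := Ψ.open_source.preimage i.continuous
  have h0S : (0 : E) ∈ S := by simpa [S] using h0
  have hΨi : ContDiffOn ℝ ∞ (fun x => Ψ (i x)) S :=
    hΨ.comp i.contDiff.contDiffOn (fun x hx => hx)
  have hdΨ : ContDiffOn ℝ ∞ (fun x => fderiv ℝ Ψ (i x)) S :=
    (hΨ.fderiv_of_isOpen Ψ.open_source (by simp)).comp i.contDiff.contDiffOn (fun x hx => hx)
  have hdΦ : ContDiffOn ℝ ∞ (fun x => fderiv ℝ Ψ.symm (Ψ (i x))) S :=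
    (hΨs.fderiv_of_isOpen Ψ.open_target (by simp)).comp hΨi (fun x hx => Ψ.map_source hx)
  let A : E → E →L[ℝ] F := fun x => J.comp ((fderiv ℝ Ψ (i x)).comp i)
  have hA : ContDiffOn ℝ ∞ A S :=
    contDiffOn_const.clm_comp (hdΨ.clm_comp contDiffOn_const)
  -- `T x` is the normal component of the `J`-rotated tangent vector.
  let T : E → E →L[ℝ] E := fun x => q.comp ((fderiv ℝ Ψ.symm (Ψ (i x))).comp (A x))
  have hT : ContDiffOn ℝ ∞ T S := contDiffOn_const.clm_comp (hdΦ.clm_comp hA)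
  have hT0 : Function.Injective (T 0) := by
    rw [injective_iff_map_eq_zero]
    intro u hu
    -- If the normal component is zero, the rotated vector `A 0 u` is itself tangent, so isotropy
    -- makes it `B`-orthogonal to itself.
    obtain ⟨s, hs⟩ := hq _ hu
    have h1 : A 0 u = fderiv ℝ Ψ 0 (i s) := by
      rw [← hs]
      have := congrArg (fun l => l (A 0 u)) (fderiv_comp_fderiv_symm hΨ hΨs h0)
      simpa using this.symm
    have h2 : A 0 u = J (fderiv ℝ Ψ 0 (i u)) := by simp [A]
    have h3 : A 0 u = 0 := by
      apply hpos
      nth_rewrite 1 [h1]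
      rw [h2]
      exact hL s u
    have h4 : fderiv ℝ Ψ 0 (i u) = 0 := hJ (by rw [← h2, h3, map_zero])
    have h5 := congrArg (fun l => l (i u)) (fderiv_symm_comp_fderiv hΨ hΨs h0)
    simp only [ContinuousLinearMap.comp_apply, h4, map_zero, ContinuousLinearMap.id_apply] at h5
    exact hi (by rw [← h5, map_zero])
  let e : E ≃L[ℝ] E := (LinearEquiv.ofInjectiveEndo (T 0 : E →ₗ[ℝ] E) hT0).toContinuousLinearEquiv
  have he : (e : E →L[ℝ] E) = T 0 := by ext u; rfl
  have : CompleteSpace E := FiniteDimensional.complete ℝ E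
  let O : Set E := S ∩ T ⁻¹' (Set.range ((↑) : (E ≃L[ℝ] E) → E →L[ℝ] E))
  have hO : IsOpen O := hT.continuousOn.isOpen_inter_preimage hS ContinuousLinearEquiv.isOpen
  have h0O : (0 : E) ∈ O := ⟨h0S, e, he⟩
  -- The required identity reads `b x ∘ T x = β x`, hence `b = β ∘ T⁻¹`.
  let β : E → E →L[ℝ] ℝ := fun x => ((-2 : ℝ) • B (Ψ (i x) - Ψ 0)).comp (A x)
  have hBΨ : ContDiffOn ℝ ∞ (fun x => (-2 : ℝ) • B (Ψ (i x) - Ψ 0)) S :=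
    ((-2 : ℝ) • B).contDiff.comp_contDiffOn (hΨi.sub contDiffOn_const)
  have hβ : ContDiffOn ℝ ∞ β S := hBΨ.clm_comp hA
  have hTinv : ContDiffOn ℝ ∞ (fun x => ContinuousLinearMap.inverse (T x)) O := by
    intro x hx
    obtain ⟨e', he'⟩ := hx.2
    have h1 : ContDiffAt ℝ ∞ ContinuousLinearMap.inverse (T x) := he' ▸ contDiffAt_map_inverse e'
    exact (h1.comp x (hT.contDiffAt (hS.mem_nhds hx.1))).contDiffWithinAt
  have hβ0 : β 0 = 0 := by simp [β]
  -- In the product rule one term contains `Ψ 0 - Ψ 0 = 0`; the other is zero by isotropy.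
  have hdβ : HasFDerivAt β (0 : E →L[ℝ] E →L[ℝ] ℝ) 0 := by
    have hd1 : HasFDerivAt (fun x => Ψ (i x)) ((fderiv ℝ Ψ 0).comp i) 0 := by
      have : HasFDerivAt Ψ (fderiv ℝ Ψ 0) (i 0) := by
        rw [map_zero]
        exact hΨ.hasFDerivAt_fderiv Ψ.open_source h0
      exact this.comp 0 i.hasFDerivAt
    have hd2 : HasFDerivAt (fun x => (-2 : ℝ) • B (Ψ (i x) - Ψ 0))
        (((-2 : ℝ) • B).comp ((fderiv ℝ Ψ 0).comp i)) 0 :=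
      (((-2 : ℝ) • B).hasFDerivAt (x := Ψ (i 0) - Ψ 0)).comp 0 (hd1.sub_const (Ψ 0))
    refine (hd2.clm_comp (hA.hasFDerivAt_fderiv hS h0S)).congr_fderiv ?_
    ext u v
    simp [A, hL u v]
  refine ⟨O, fun x => (β x).comp (ContinuousLinearMap.inverse (T x)), hO, h0O,
    (hβ.mono Set.inter_subset_left).clm_comp hTinv, by simp [hβ0], ?_, ?_⟩
  · have h1 := hTinv.hasFDerivAt_fderiv hO h0O
    rw [(hdβ.clm_comp h1).fderiv]
    ext u v
    simp [hβ0]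
  · intro x hx u
    obtain ⟨e', he'⟩ := hx.2
    have h1 : ContinuousLinearMap.inverse (T x) (T x u) = u := by
      rw [← he', ContinuousLinearMap.inverse_equiv]; simp
    have h2 : q (fderiv ℝ Ψ.symm (Ψ (i x)) (J (fderiv ℝ Ψ (i x) (i u)))) = T x u := rfl
    rw [h2, ContinuousLinearMap.comp_apply, h1]
    simp [β, A]

set_option maxSynthPendingDepth 3 in
/-- The function `b(X)Y` has vanishing `2`-jet at a common zero of `X` and `Y` when `b` has
vanishing `1`-jet. -/
theorem contDiffOn_fderiv_pairing {b : E → E →L[ℝ] ℝ} {O : Set E} (hO : IsOpen O)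
    (hb : ContDiffOn ℝ ∞ b O) (hb0 : b 0 = 0) (hdb0 : fderiv ℝ b 0 = 0) {X Y : F → E}
    {U : Set F} (hU : IsOpen U) (hX : ContDiffOn ℝ ∞ X U) (hY : ContDiffOn ℝ ∞ Y U)
    (hXO : ∀ ζ ∈ U, X ζ ∈ O) {p : F} (hp : p ∈ U) (hXp : X p = 0) (hYp : Y p = 0) :
    ContDiffOn ℝ ∞ (fun ζ => b (X ζ) (Y ζ)) U ∧
      (∀ ζ ∈ U, ∀ v, fderiv ℝ (fun ζ => b (X ζ) (Y ζ)) ζ v =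
        b (X ζ) (fderiv ℝ Y ζ v) + fderiv ℝ b (X ζ) (fderiv ℝ X ζ v) (Y ζ)) ∧
      HasFDerivAt (fderiv ℝ (fun ζ => b (X ζ) (Y ζ))) (0 : F →L[ℝ] F →L[ℝ] ℝ) p := by
  have hbX : ContDiffOn ℝ ∞ (fun ζ => b (X ζ)) U := hb.comp hX hXO
  have hdX : ∀ ζ ∈ U, HasFDerivAt X (fderiv ℝ X ζ) ζ := fun _ hζ =>
    hX.hasFDerivAt_fderiv hU hζ
  have hdY : ∀ ζ ∈ U, HasFDerivAt Y (fderiv ℝ Y ζ) ζ := fun _ hζ =>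
    hY.hasFDerivAt_fderiv hU hζ
  have hdb : ∀ ζ ∈ U, HasFDerivAt (fun ζ => b (X ζ)) ((fderiv ℝ b (X ζ)).comp (fderiv ℝ X ζ)) ζ :=
    fun ζ hζ => (hb.hasFDerivAt_fderiv hO (hXO ζ hζ)).comp ζ (hdX ζ hζ)
  have hform : ∀ ζ ∈ U, fderiv ℝ (fun ζ => b (X ζ) (Y ζ)) ζ = (b (X ζ)).comp (fderiv ℝ Y ζ) +
      (ContinuousLinearMap.apply ℝ ℝ (Y ζ)).comp ((fderiv ℝ b (X ζ)).comp (fderiv ℝ X ζ)) := by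
    intro ζ hζ
    rw [((hdb ζ hζ).clm_apply (hdY ζ hζ)).fderiv]
    ext v
    simp
  refine ⟨hbX.clm_apply hY, fun ζ hζ v => by rw [hform ζ hζ]; simp, ?_⟩
  -- Every term of the second derivative at `p` contains `b 0`, `fderiv ℝ b 0` or `Y p`.
  have h1 := (hdb p hp).clm_comp
    ((hY.fderiv_of_isOpen hU (m := ∞) (by simp)).hasFDerivAt_fderiv hU hp)
  let ev : E →L[ℝ] (E →L[ℝ] ℝ) →L[ℝ] ℝ := ContinuousLinearMap.apply ℝ ℝ
  have hev : ContDiffOn ℝ ∞ (fun ζ => ev (Y ζ)) U :=  ev.contDiff.comp_contDiffOn hY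
  have h2 := hev.hasFDerivAt_fderiv hU hp
  have h3 : HasFDerivAt (fun ζ => (fderiv ℝ b (X ζ)).comp (fderiv ℝ X ζ)) _ p :=
    (((hb.fderiv_of_isOpen hO (m := ∞) (by simp)).comp hX hXO).clm_comp
      (hX.fderiv_of_isOpen hU (m := ∞) (by simp))).hasFDerivAt_fderiv hU hp
  have h4 := h1.add (h2.clm_comp h3)
  refine (h4.congr_of_eventuallyEq
    (Filter.eventuallyEq_of_mem (hU.mem_nhds hp) hform)).congr_fderiv ?_
  ext u v
  simp [ev, hXp, hYp, hb0, hdb0]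

end LocalAnalysis

/-! ### Correcting the quadratic function along both branches. -/

set_option maxSynthPendingDepth 3 in
/-- In the image of a product under a local diffeomorphism `Ψ`, both of whose factors have
`B(·, J·)`-isotropic tangent planes at `Ψ 0`, there is a function with Hessian `2B` at `Ψ 0` whose
differential vanishes on the `J`-rotated tangent planes of the two factors. -/
theorem exists_function_of_isotropic {E F : Type*} [NormedAddCommGroup E] [NormedSpace ℝ E]
    [NormedAddCommGroup F] [NormedSpace ℝ F] [FiniteDimensional ℝ E]
    {Ψ : OpenPartialHomeomorph (E × E) F}
    (hΨ : ContDiffOn ℝ ∞ Ψ Ψ.source) (hΨs : ContDiffOn ℝ ∞ Ψ.symm Ψ.target)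
    (h0 : (0 : E × E) ∈ Ψ.source) (J : F →L[ℝ] F) (hJ : Function.Injective J)
    (B : F →L[ℝ] F →L[ℝ] ℝ) (hB : ∀ v w, B v w = B w v) {c : ℝ} (hc : 0 < c)
    (hpos : ∀ v, c * ‖v‖ ^ 2 ≤ B v v)
    (hL₁ : ∀ u u', B (fderiv ℝ Ψ 0 (u, 0)) (J (fderiv ℝ Ψ 0 (u', 0))) = 0)
    (hL₂ : ∀ u u', B (fderiv ℝ Ψ 0 (0, u)) (J (fderiv ℝ Ψ 0 (0, u'))) = 0) :
    ∃ (U : Set F) (f : F → ℝ), IsOpen U ∧ Ψ 0 ∈ U ∧ U ⊆ Ψ.target ∧ ContDiffOn ℝ ∞ f U ∧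
      (∀ ζ ∈ U, (Ψ.symm ζ).2 = 0 → ∀ u, fderiv ℝ f ζ (J (fderiv ℝ Ψ (Ψ.symm ζ) (u, 0))) = 0) ∧
      (∀ ζ ∈ U, (Ψ.symm ζ).1 = 0 → ∀ u, fderiv ℝ f ζ (J (fderiv ℝ Ψ (Ψ.symm ζ) (0, u))) = 0) ∧
      fderiv ℝ f (Ψ 0) = 0 ∧
      ∀ ζ ∈ U, ∀ v, v ≠ 0 → 0 < fderiv ℝ (fderiv ℝ f) ζ v v := by
  have hpos' : ∀ v, B v v = 0 → v = 0 := fun v hv => by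
    have h1 := hpos v
    rw [hv] at h1
    have h2 : ‖v‖ ^ 2 = 0 := le_antisymm (by by_contra h; push Not at h; nlinarith) (sq_nonneg _)
    simpa using h2
  obtain ⟨O₁, b₁, hO₁, h0₁, hb₁, hb₁0, hdb₁, hcan₁⟩ := exists_normal_correction hΨ hΨs h0
    (ContinuousLinearMap.inl ℝ E E) (ContinuousLinearMap.snd ℝ E E)
    (fun a b h => by simpa using h) (fun w hw => ⟨w.1, Prod.ext rfl hw⟩) J hJ B hpos'
    (by simpa using hL₁)
  obtain ⟨O₂, b₂, hO₂, h0₂, hb₂, hb₂0, hdb₂, hcan₂⟩ := exists_normal_correction hΨ hΨs h0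
    (ContinuousLinearMap.inr ℝ E E) (ContinuousLinearMap.fst ℝ E E)
    (fun a b h => by simpa using h) (fun w hw => ⟨w.2, Prod.ext hw rfl⟩) J hJ B hpos'
    (by simpa using hL₂)
  set p := Ψ 0
  have hsymm_p : Ψ.symm p = 0 := Ψ.left_inv h0
  let X : F → E := fun ζ => (Ψ.symm ζ).1
  let Y : F → E := fun ζ => (Ψ.symm ζ).2
  let U₀ : Set F := Ψ.target ∩ Ψ.symm ⁻¹' (O₁ ×ˢ O₂)
  have hU₀ : IsOpen U₀ := Ψ.isOpen_inter_preimage_symm (hO₁.prod hO₂)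
  have hpU₀ : p ∈ U₀ := ⟨Ψ.map_source h0, by simp [hsymm_p, h0₁, h0₂]⟩
  have hsU : ContDiffOn ℝ ∞ Ψ.symm U₀ := hΨs.mono Set.inter_subset_left
  have hX : ContDiffOn ℝ ∞ X U₀ := contDiff_fst.comp_contDiffOn hsU
  have hY : ContDiffOn ℝ ∞ Y U₀ := contDiff_snd.comp_contDiffOn hsU
  have hdX : ∀ ζ ∈ U₀, ∀ v, fderiv ℝ X ζ v = (fderiv ℝ Ψ.symm ζ v).1 := fun ζ hζ v => by
    rw [(hsU.hasFDerivAt_fderiv hU₀ hζ).fst.fderiv]; rfl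
  have hdY : ∀ ζ ∈ U₀, ∀ v, fderiv ℝ Y ζ v = (fderiv ℝ Ψ.symm ζ v).2 := fun ζ hζ v => by
    rw [(hsU.hasFDerivAt_fderiv hU₀ hζ).snd.fderiv]; rfl
  have hX0 : X p = 0 := by simp [X, hsymm_p]
  have hY0 : Y p = 0 := by simp [Y, hsymm_p]
  obtain ⟨hk₁, hdk₁, hddk₁⟩ := contDiffOn_fderiv_pairing hO₁ hb₁ hb₁0 hdb₁ hU₀ hX hY
    (fun ζ hζ => hζ.2.1) hpU₀ hX0 hY0
  obtain ⟨hk₂, hdk₂, hddk₂⟩ := contDiffOn_fderiv_pairing hO₂ hb₂ hb₂0 hdb₂ hU₀ hY hX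
    (fun ζ hζ => hζ.2.2) hpU₀ hY0 hX0
  set k₁ : F → ℝ := fun ζ => b₁ (X ζ) (Y ζ)
  set k₂ : F → ℝ := fun ζ => b₂ (Y ζ) (X ζ)
  let Q : F → ℝ := fun ζ => B (ζ - p) (ζ - p)
  have hsub : ContDiff ℝ ∞ (fun ζ : F => ζ - p) := contDiff_id.sub contDiff_const
  have hQ : ContDiff ℝ ∞ Q := (B.contDiff.comp hsub).clm_apply hsub
  have hdQ : ∀ ζ, HasFDerivAt Q ((2 : ℝ) • B (ζ - p)) ζ := fun ζ => by
    have h1 : HasFDerivAt (fun ζ : F => ζ - p) (.id ℝ F) ζ := (hasFDerivAt_id ζ).sub_const p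
    have h2 : HasFDerivAt (fun ζ : F => B (ζ - p)) (B.comp (.id ℝ F)) ζ :=
      (B.hasFDerivAt (x := ζ - p)).comp ζ h1
    refine (h2.clm_apply h1).congr_fderiv ?_
    ext v
    simp [hB v ζ, hB v p, two_mul]
  let f : F → ℝ := fun ζ => Q ζ + k₁ ζ + k₂ ζ
  have hf : ContDiffOn ℝ ∞ f U₀ := (hQ.contDiffOn.add hk₁).add hk₂
  have hdf : ∀ ζ ∈ U₀, fderiv ℝ f ζ = (2 : ℝ) • B (ζ - p) + fderiv ℝ k₁ ζ + fderiv ℝ k₂ ζ :=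
    fun ζ hζ => (((hdQ ζ).add (hk₁.hasFDerivAt_fderiv hU₀ hζ)).add
      (hk₂.hasFDerivAt_fderiv hU₀ hζ)).fderiv
  have hddf : HasFDerivAt (fderiv ℝ f) ((2 : ℝ) • B) p := by
    have h1 : HasFDerivAt (fun ζ : F => (2 : ℝ) • B (ζ - p)) ((2 : ℝ) • B) p := by
      have h2 : HasFDerivAt (fun ζ : F => ζ - p) (.id ℝ F) p := (hasFDerivAt_id p).sub_const p
      have h3 : HasFDerivAt ((2 : ℝ) • B) ((2 : ℝ) • B) (p - p) := ((2 : ℝ) • B).hasFDerivAt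
      exact HasFDerivAt.comp (f := fun ζ : F => ζ - p) p h3 h2
    exact (((h1.add hddk₁).add hddk₂).congr_of_eventuallyEq
      (Filter.eventuallyEq_of_mem (hU₀.mem_nhds hpU₀) hdf)).congr_fderiv (by simp)
  have hcont : ContinuousOn (fderiv ℝ (fderiv ℝ f)) U₀ :=
    (hf.fderiv_of_isOpen hU₀ (m := ∞) (by simp)).continuousOn_fderiv_of_isOpen hU₀ (by simp)
  -- Since `2B(v, v) ≥ 2c‖v‖²`, a Hessian within `c` of `2B` is still positive definite.
  let U : Set F := U₀ ∩ fderiv ℝ (fderiv ℝ f) ⁻¹' Metric.ball ((2 : ℝ) • B) c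
  have hUU : U ⊆ U₀ := Set.inter_subset_left
  refine ⟨U, f, hcont.isOpen_inter_preimage hU₀ Metric.isOpen_ball, ⟨hpU₀, ?_⟩,
    fun ζ hζ => hζ.1.1, hf.mono hUU, ?_, ?_, ?_, ?_⟩
  · simpa [hddf.fderiv] using hc
  · intro ζ hζ hy u
    have hζ₀ := hUU hζ
    have hx : X ζ ∈ O₁ := hζ₀.2.1
    have hY : Y ζ = 0 := hy
    have hs : Ψ.symm ζ = (X ζ, 0) := Prod.ext rfl hy
    have h1 := hcan₁ (X ζ) hx u
    simp only [ContinuousLinearMap.inl_apply, ContinuousLinearMap.coe_snd', ← hs,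
      Ψ.right_inv hζ₀.1] at h1
    rw [hdf ζ hζ₀]
    -- Where `Y = 0`, `k₂` drops out because `b₂` has zero 1-jet at 0, and `k₁` contributes only
    -- `b₁(X) dY`, which `hcan₁` balances against `dQ`.
    simp only [add_apply, smul_apply, smul_eq_mul,
      hdk₁ ζ hζ₀, hdk₂ ζ hζ₀, hY, hb₂0, hdb₂, hdY ζ hζ₀, map_zero,
      zero_apply, add_zero]
    exact h1
  · intro ζ hζ hx u
    have hζ₀ := hUU hζ
    have hy : Y ζ ∈ O₂ := hζ₀.2.2
    have hX : X ζ = 0 := hx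
    have hs : Ψ.symm ζ = (0, Y ζ) := Prod.ext hx rfl
    have h1 := hcan₂ (Y ζ) hy u
    simp only [ContinuousLinearMap.inr_apply, ContinuousLinearMap.coe_fst', ← hs,
      Ψ.right_inv hζ₀.1] at h1
    rw [hdf ζ hζ₀]
    simp only [add_apply, smul_apply, smul_eq_mul,
      hdk₁ ζ hζ₀, hdk₂ ζ hζ₀, hX, hb₁0, hdb₁, hdX ζ hζ₀, map_zero,
      zero_apply, add_zero]
    exact h1
  · rw [hdf p hpU₀]
    ext v
    simp [hdk₁ p hpU₀, hdk₂ p hpU₀, hX0, hY0, hb₁0, hb₂0]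
  · intro ζ hζ v hv
    set H := fderiv ℝ (fderiv ℝ f) ζ
    have hH : ‖H - (2 : ℝ) • B‖ < c := by simpa [dist_eq_norm] using hζ.2
    have h1 : |(H - (2 : ℝ) • B) v v| ≤ ‖H - (2 : ℝ) • B‖ * ‖v‖ * ‖v‖ :=
      (H - (2 : ℝ) • B).le_opNorm₂ v v
    have h2 := (abs_le.1 h1).1
    simp only [sub_apply, smul_apply, smul_eq_mul] at h2
    have hv2 : 0 < ‖v‖ ^ 2 := by positivity
    nlinarith [hpos v, mul_lt_mul_of_pos_right hH hv2]

/-! ### `dᶜ` and `ddᶜ` through real derivatives. -/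

theorem dc_apply {n : ℕ} (f : Cn n → ℝ) (z v : Cn n) :
    dc f z v = -fderiv ℝ f z (Complex.I • v) := by
  have h : Complex.I • v = ∑ j, ((v j).re • EuclideanSpace.single j Complex.I
      - (v j).im • EuclideanSpace.single j (1 : ℂ)) := by
    ext k
    have h1 : (v k).re * Complex.I - (v k).im = Complex.I * v k := by
      apply Complex.ext <;> simp
    simp [Pi.single_apply, h1]
  rw [h, map_sum, dc, sum_apply, ← Finset.sum_neg_distrib]
  refine Finset.sum_congr rfl fun j _ => ?_
  simp [partialX, partialY, dxForm, dyForm]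
  ring

/-- With `dᶜf = -df ∘ J`, the two terms of the exterior derivative are `-D²f(v, J²v)` and `D²f(Jv,
Jv)`, and `J² = -1`. Positive definiteness of the real Hessian thus suffices for `ddᶜf > 0`. -/
theorem ddc_apply_I_smul {n : ℕ} {f : Cn n → ℝ} {z : Cn n}
    (hf : DifferentiableAt ℝ (fderiv ℝ f) z) (v : Cn n) :
    ddc f z ![v, Complex.I • v] =
      fderiv ℝ (fderiv ℝ f) z v v
        + fderiv ℝ (fderiv ℝ f) z (Complex.I • v) (Complex.I • v) := by
  let J : Cn n →L[ℝ] Cn n := (Complex.I • ContinuousLinearMap.id ℂ (Cn n)).restrictScalars ℝ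
  have hdc : dc f = fun ζ => -(fderiv ℝ f ζ).comp J := by
    ext ζ v
    simp [dc_apply, J]
  have hd : HasFDerivAt (dc f) (-((ContinuousLinearMap.compL ℝ (Cn n) (Cn n) ℝ).flip J).comp
      (fderiv ℝ (fderiv ℝ f) z)) z := by
    rw [hdc]
    exact ((((ContinuousLinearMap.compL ℝ (Cn n) (Cn n) ℝ).flip J).hasFDerivAt).comp z
      hf.hasFDerivAt).neg
  have hd' : DifferentiableAt ℝ (fun ζ => ContinuousAlternatingMap.ofSubsingleton ℝ (Cn n) ℝ
      (0 : Fin 1) (dc f ζ)) z :=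
    (ContinuousAlternatingMap.ofSubsingletonLIE (𝕜 := ℝ) (E := Cn n) (F := ℝ)
      (0 : Fin 1)).toContinuousLinearEquiv.differentiableAt.comp z hd.differentiableAt
  have key : ∀ w a : Cn n, fderiv ℝ (fun ζ => dc f ζ w) z a =
      -fderiv ℝ (fderiv ℝ f) z a (Complex.I • w) := by
    intro w a
    have h1 := (hd.clm_apply (hasFDerivAt_const w z)).fderiv
    rw [h1]
    simp [J]
  rw [ddc, extDeriv_apply hd']
  simp only [ContinuousAlternatingMap.ofSubsingleton_apply_apply]
  simp [key, Fin.removeNth, smul_smul, add_comm]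

/-! ### The metric adapted to the two tangent planes. -/

/-- Real diagonalizability yields a Hermitian metric for which `ℝⁿ` and `(A + i)ℝⁿ`, and
hence their preimages under `G`, are Lagrangian. -/
theorem exists_lagrangian_form {n : ℕ} {S₁ S₂ : Set (Cn n)} (G : Cn n ≃ₗ[ℂ] Cn n)
    {A : Matrix (Fin n) (Fin n) ℝ} (h₁ : G '' S₁ = realPlane n) (h₂ : G '' S₂ = graphPlane A)
    (hA : IsRealDiagonalizable A) :
    ∃ (B : Cn n →L[ℝ] Cn n →L[ℝ] ℝ) (c : ℝ), (∀ v w, B v w = B w v) ∧ 0 < c ∧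
      (∀ v, c * ‖v‖ ^ 2 ≤ B v v) ∧ (∀ v ∈ S₁, ∀ w ∈ S₁, B v (Complex.I • w) = 0) ∧
      ∀ v ∈ S₂, ∀ w ∈ S₂, B v (Complex.I • w) = 0 := by
  obtain ⟨P, d, hP, rfl⟩ := hA
  have hPdet : IsUnit P.det := (Matrix.isUnit_iff_isUnit_det P).1 hP
  -- Being real, `P⁻¹` preserves `ℝⁿ`, and it carries `(A + i)ℝⁿ` to `(D + i)ℝⁿ` with `D` diagonal.
  -- This is a product of real lines, Lagrangian for the standard metric; `B` is that metric pulled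
  -- back by `L = P⁻¹G`.
  let N : Matrix (Fin n) (Fin n) ℂ := P⁻¹.map Complex.ofReal
  let L : Cn n →ₗ[ℂ] Cn n := (Matrix.toEuclideanLin N).comp (G : Cn n →ₗ[ℂ] Cn n)
  have hL : ∀ v j, L v j = ∑ k, ((P⁻¹ j k : ℝ) : ℂ) * G v k := fun v j => by
    simp [L, N, Matrix.toLpLin_apply, Matrix.mulVec, dotProduct]
  have hre : ∀ v j, (L v j).re = P⁻¹.mulVec (fun k => (G v k).re) j := fun v j => by
    rw [hL, Complex.re_sum]; simp [Matrix.mulVec, dotProduct]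
  have him : ∀ v j, (L v j).im = P⁻¹.mulVec (fun k => (G v k).im) j := fun v j => by
    rw [hL, Complex.im_sum]; simp [Matrix.mulVec, dotProduct]
  have hinj : Function.Injective L := by
    rw [injective_iff_map_eq_zero]
    intro v hv
    have hP1 : ∀ x : Fin n → ℝ, P⁻¹.mulVec x = 0 → x = 0 := fun x hx => by
      have := congrArg P.mulVec hx
      simpa [Matrix.mulVec_mulVec, Matrix.mul_nonsing_inv P hPdet] using this
    have hr := hP1 (fun k => (G v k).re) (by ext j; rw [← hre, hv]; simp)
    have hi := hP1 (fun k => (G v k).im) (by ext j; rw [← him, hv]; simp)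
    have : G v = 0 := by
      ext k
      exact Complex.ext (congrFun hr k) (congrFun hi k)
    simpa using this
  let LR : Cn n →L[ℝ] Cn n := (LinearMap.toContinuousLinearMap L).restrictScalars ℝ
  let B : Cn n →L[ℝ] Cn n →L[ℝ] ℝ := ∑ j,
    (((dxForm j).comp LR).smulRight ((dxForm j).comp LR) +
      ((dyForm j).comp LR).smulRight ((dyForm j).comp LR))
  have hBap : ∀ v w, B v w = ∑ j, ((L v j).re * (L w j).re + (L v j).im * (L w j).im) :=
    fun v w => by
      simp [B, dxForm, dyForm, LR]
  have hI : ∀ v w, B v (Complex.I • w) =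
      ∑ j, ((L v j).im * (L w j).re - (L v j).re * (L w j).im) := fun v w => by
    rw [hBap]
    refine Finset.sum_congr rfl fun j _ => ?_
    simp
    ring
  obtain ⟨K, hK, hKL⟩ := L.exists_antilipschitzWith (LinearMap.ker_eq_bot.2 hinj)
  have hK' : (0 : ℝ) < K := hK
  refine ⟨B, ((K : ℝ) ^ 2)⁻¹, fun v w => ?_, by positivity, fun v => ?_, fun v hv w hw => ?_,
    fun v hv w hw => ?_⟩
  · simp only [hBap, mul_comm]
  · have h1 : ‖v‖ ≤ K * ‖L v‖ := by
      have := hKL.le_mul_dist v 0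
      simpa using this
    have h2 : B v v = ‖L v‖ ^ 2 := by
      rw [hBap, EuclideanSpace.norm_sq_eq]
      refine Finset.sum_congr rfl fun j _ => ?_
      rw [← Complex.normSq_eq_norm_sq, Complex.normSq_apply]
    rw [h2, inv_mul_le_iff₀ (by positivity), ← mul_pow]
    exact pow_le_pow_left₀ (norm_nonneg _) h1 2
  · have hz : ∀ v ∈ S₁, ∀ j, (L v j).im = 0 := fun v hv j => by
      have : G v ∈ realPlane n := h₁ ▸ Set.mem_image_of_mem G hv
      rw [him, show (fun k => (G v k).im) = 0 from funext this]
      simp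
    rw [hI]
    simp [hz v hv, hz w hw]
  · have hz : ∀ v ∈ S₂, ∀ j, (L v j).re = d j * (L v j).im := fun v hv j => by
      have : G v ∈ graphPlane (P * Matrix.diagonal d * P⁻¹) := h₂ ▸ Set.mem_image_of_mem G hv
      obtain ⟨x, hx⟩ := this
      rw [him, hre, show (fun k => (G v k).im) = x from funext fun k => (hx k).2,
        show (fun k => (G v k).re) = _ from funext fun k => (hx k).1, Matrix.mulVec_mulVec,
        Matrix.mul_assoc, ← Matrix.mul_assoc, Matrix.nonsing_inv_mul P hPdet, Matrix.one_mul,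
        ← Matrix.mulVec_mulVec, Matrix.mulVec_diagonal]
    rw [hI]
    refine Finset.sum_eq_zero fun j _ => ?_
    rw [hz v hv, hz w hw]
    ring

/-! ### Parametrizing the branches. -/

section Parametrization

variable {n : ℕ} {M : Type*} [TopologicalSpace M] [ChartedSpace (EuclideanSpace ℝ (Fin n)) M]

/-- A chart inverse, translated to start at 0. The last clause turns a neighbourhood in the
parameter space into one in `M`, the form in which `branches` can be applied. -/
theorem exists_parametrization [IsManifold (𝓡 n) ∞ M] {ι : M → Cn n} (hι : ContMDiff (𝓡 n) 𝓘(ℝ, Cn n) ∞ ι) (z : M) :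
    ∃ (O : Set (EuclideanSpace ℝ (Fin n))) (γ : EuclideanSpace ℝ (Fin n) → Cn n),
      IsOpen O ∧ 0 ∈ O ∧ ContDiffOn ℝ ∞ γ O ∧ γ 0 = ι z ∧
      (∀ v, fderiv ℝ γ 0 v ∈ tangentPlane ι z) ∧
      (∀ a ∈ tangentPlane ι z, ∃ v, fderiv ℝ γ 0 v = a) ∧
      ∀ N ∈ 𝓝 (0 : EuclideanSpace ℝ (Fin n)), ∃ V ∈ 𝓝 z, ∀ z' ∈ V, ∃ x ∈ N, γ x = ι z' := by
  let φ := extChartAt (𝓡 n) z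
  let g : EuclideanSpace ℝ (Fin n) → Cn n := fun x => ι (φ.symm x)
  have hopen : IsOpen φ.target := isOpen_extChartAt_target z
  have hg : ContDiffOn ℝ ∞ g φ.target :=
    (hι.comp_contMDiffOn (contMDiffOn_extChartAt_symm z)).contDiffOn
  let τ : EuclideanSpace ℝ (Fin n) → EuclideanSpace ℝ (Fin n) := fun x => φ z + x
  have hτ : ContDiff ℝ ∞ τ := contDiff_const.add contDiff_id
  let D : EuclideanSpace ℝ (Fin n) →L[ℝ] Cn n := pushforward ι z
  have hfd : fderiv ℝ (fun x => g (τ x)) 0 = D := by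
    have h1 : fderiv ℝ (fun x => g (τ x)) 0 = fderiv ℝ g (φ z) := by
      simp only [τ, fderiv_comp_add_left, add_zero]
    have h2 : MDifferentiableAt (𝓡 n) 𝓘(ℝ, Cn n) ι z := (hι z).mdifferentiableAt (by simp)
    have h3 : HasFDerivWithinAt g D (Set.range (𝓡 n)) (φ z) := h2.hasMFDerivAt.2
    rw [modelWithCornersSelf_coe, Set.range_id, hasFDerivWithinAt_univ] at h3
    rw [h1]
    exact h3.fderiv
  refine ⟨τ ⁻¹' φ.target, fun x => g (τ x), hopen.preimage hτ.continuous, ?_,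
    hg.comp hτ.contDiffOn (fun x hx => hx), ?_, ?_, ?_, ?_⟩
  · simp [τ, φ]
  · simp [τ, φ, g]
  · intro v
    rw [hfd]
    exact ⟨v, rfl⟩
  · rintro a ⟨v, rfl⟩
    exact ⟨v, by rw [hfd]; rfl⟩
  · intro N hN
    have hc : ContinuousAt (fun z' => φ z' - φ z) z :=
      (continuousAt_extChartAt z).sub continuousAt_const
    refine ⟨φ.source ∩ (fun z' => φ z' - φ z) ⁻¹' N,
      Filter.inter_mem (extChartAt_source_mem_nhds z) (hc.preimage_mem_nhds (by simpa using hN)),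
      fun z' hz' => ⟨φ z' - φ z, hz'.2, ?_⟩⟩
    simp [τ, g, φ.left_inv hz'.1]

/-- The differential of a map whose values near `u` lie in the zero set of `q ∘ Ψ⁻¹` is tangent to
that zero set. -/
theorem map_fderiv_symm_pushforward_eq_zero {E' H : Type*} [NormedAddCommGroup E']
    [NormedSpace ℝ E'] [NormedAddCommGroup H] [NormedSpace ℝ H] {ι : M → Cn n}
    (hι : ContMDiff (𝓡 n) 𝓘(ℝ, Cn n) ∞ ι) {Φ : Cn n → E'} {u : M}
    (hΦ : DifferentiableAt ℝ Φ (ι u)) (q : E' →L[ℝ] H)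
    (hq : ∀ᶠ u' in 𝓝 u, q (Φ (ι u')) = 0) (v : TangentSpace (𝓡 n) u) :
    q (fderiv ℝ Φ (ι u) (pushforward ι u v)) = 0 := by
  have h1 : HasMFDerivAt (𝓡 n) 𝓘(ℝ, Cn n) ι u (pushforward ι u) :=
    ((hι u).mdifferentiableAt (by simp)).hasMFDerivAt
  have h2 : HasFDerivAt (fun ζ => q (Φ ζ)) (q.comp (fderiv ℝ Φ (ι u))) (ι u) :=
    q.hasFDerivAt.comp _ hΦ.hasFDerivAt
  have h3 := h2.hasMFDerivAt.comp u h1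
  have h4 : HasMFDerivAt (𝓡 n) 𝓘(ℝ, H) (fun _ : M => (0 : H)) u
      (0 : TangentSpace (𝓡 n) u →L[ℝ] TangentSpace 𝓘(ℝ, H) (0 : H)) := hasMFDerivAt_const 0 u
  have h5 := hasMFDerivAt_unique h3 (h4.congr_of_eventuallyEq hq)
  exact congrArg (fun l => l v) h5

end Parametrization

/-! ### Assembling the proof. -/

theorem lemma4p1 (n : ℕ) (M : Type*) [TopologicalSpace M]
    [ChartedSpace (EuclideanSpace ℝ (Fin n)) M] [IsManifold (𝓡 n) ∞ M]
    (ι : M → Cn n) (hι : Manifold.IsImmersion (𝓡 n) 𝓘(ℝ, Cn n) ∞ ι) (hreal : IsTotallyReal ι)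
    (p : Cn n) (hp : IsIsolatedDiagonalizableDoublePoint ι p) :
    ∃ (U : Set (Cn n)) (f : Cn n → ℝ), IsOpen U ∧ p ∈ U ∧ ContDiffOn ℝ ∞ f U ∧
      (∀ z ∈ ι ⁻¹' U, pullback ι (dc f) z = 0) ∧
      (∀ ζ ∈ U, IsPositiveForm (ddc f ζ)) := by
  have hsm : ContMDiff (𝓡 n) 𝓘(ℝ, Cn n) ∞ ι := hι.contMDiff
  obtain ⟨z, w, hzw, G, A, hG₁, hG₂, hA⟩ := hp
  obtain ⟨B, c, hB, hc, hpos, hL₁, hL₂⟩ := exists_lagrangian_form G hG₁ hG₂ hA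
  obtain ⟨O₁, γ₁, hO₁, h0₁, hγ₁, hγ₁0, hmem₁, hsurj₁, hnhds₁⟩ := exists_parametrization hsm z
  obtain ⟨O₂, γ₂, hO₂, h0₂, hγ₂, hγ₂0, hmem₂, hsurj₂, hnhds₂⟩ := exists_parametrization hsm w
  rw [hzw.map_left] at hγ₁0
  rw [hzw.map_right] at hγ₂0
  let E := EuclideanSpace ℝ (Fin n)
  -- Subtracting `p` gives `ψ (x, 0) = γ₁ x` and `ψ (0, y) = γ₂ y`; transversality makes `ψ` a local
  -- diffeomorphism at 0.
  let ψ : E × E → Cn n := fun x => γ₁ x.1 + γ₂ x.2 - p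
  have hψ : ContDiffOn ℝ ∞ ψ (O₁ ×ˢ O₂) :=
    ((hγ₁.comp contDiff_fst.contDiffOn fun x hx => hx.1).add
      (hγ₂.comp contDiff_snd.contDiffOn fun x hx => hx.2)).sub contDiffOn_const
  have hdψ : fderiv ℝ ψ 0 = (fderiv ℝ γ₁ 0).coprod (fderiv ℝ γ₂ 0) := by
    have h1 : HasFDerivAt (fun x : E × E => γ₁ x.1)
        ((fderiv ℝ γ₁ 0).comp (ContinuousLinearMap.fst ℝ E E)) 0 :=
      HasFDerivAt.comp (f := Prod.fst) (0 : E × E) (hγ₁.hasFDerivAt_fderiv hO₁ h0₁) hasFDerivAt_fst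
    have h2 : HasFDerivAt (fun x : E × E => γ₂ x.2)
        ((fderiv ℝ γ₂ 0).comp (ContinuousLinearMap.snd ℝ E E)) 0 :=
      HasFDerivAt.comp (f := Prod.snd) (0 : E × E) (hγ₂.hasFDerivAt_fderiv hO₂ h0₂) hasFDerivAt_snd
    have h3 : HasFDerivAt ψ _ 0 := (h1.add h2).sub_const p
    rw [h3.fderiv]
    ext v <;> simp
  have hsurj : Function.Surjective (fderiv ℝ ψ 0) := by
    intro a
    have ha : a ∈ tangentPlane ι z ⊔ tangentPlane ι w := by
      rw [hzw.transverse.sup_eq_top]; trivial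
    obtain ⟨a₁, ha₁, a₂, ha₂, rfl⟩ := Submodule.mem_sup.1 ha
    obtain ⟨v₁, rfl⟩ := hsurj₁ a₁ ha₁
    obtain ⟨v₂, rfl⟩ := hsurj₂ a₂ ha₂
    exact ⟨(v₁, v₂), by simp [hdψ]⟩
  have hfin : Module.finrank ℝ (E × E) = Module.finrank ℝ (Cn n) := by
    rw [Module.finrank_prod, ← Module.finrank_mul_finrank ℝ ℂ (Cn n), Complex.finrank_real_complex]
    simp [E, two_mul]
  have hbij : Function.Bijective (fderiv ℝ ψ 0) :=
    ⟨(LinearMap.injective_iff_surjective_of_finrank_eq_finrank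
      (f := (fderiv ℝ ψ 0 : E × E →ₗ[ℝ] Cn n)) hfin).2 hsurj, hsurj⟩
  obtain ⟨Ψ, hΨψ, h0, hΨ, hΨs⟩ := exists_openPartialHomeomorph_contDiffOn
    (hO₁.prod hO₂) hψ (a := 0) ⟨h0₁, h0₂⟩ hbij
  have hΨ0 : Ψ 0 = p := by simp [hΨψ, ψ, hγ₁0, hγ₂0]
  let J : Cn n →L[ℝ] Cn n := (Complex.I • ContinuousLinearMap.id ℂ (Cn n)).restrictScalars ℝ
  have hJa : ∀ v, J v = Complex.I • v := fun v => by simp [J]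
  have hJ : Function.Injective J := fun a b hab => by
    simpa [hJa, Complex.I_ne_zero] using hab
  obtain ⟨U₀, f, hU₀, hp₀, hUt, hf, hf₁, hf₂, hfp, hHess⟩ := exists_function_of_isotropic
    hΨ hΨs h0 J hJ B hB hc hpos
    (fun u u' => by simpa [hΨψ, hdψ, hJa] using hL₁ _ (hmem₁ u) _ (hmem₁ u'))
    (fun u u' => by simpa [hΨψ, hdψ, hJa] using hL₂ _ (hmem₂ u) _ (hmem₂ u'))
  rw [hΨ0] at hp₀ hfp
  obtain ⟨V, hV, hVx⟩ := hnhds₁ ((fun x : E => (x, (0 : E))) ⁻¹' Ψ.source)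
    ((Ψ.open_source.preimage (by fun_prop)).mem_nhds h0)
  obtain ⟨W, hW, hWx⟩ := hnhds₂ ((fun y : E => ((0 : E), y)) ⁻¹' Ψ.source)
    ((Ψ.open_source.preimage (by fun_prop)).mem_nhds h0)
  obtain ⟨N, hN, hNVW⟩ := hzw.branches V hV W hW
  let U : Set (Cn n) := U₀ ∩ interior N
  have hUo : IsOpen U := hU₀.inter isOpen_interior
  have hbranch : ∀ u : M, ι u ∈ U → (Ψ.symm (ι u)).2 = 0 ∨ (Ψ.symm (ι u)).1 = 0 := by
    intro u hu
    rcases hNVW ⟨⟨u, rfl⟩, interior_subset hu.2⟩ with ⟨z', hz', h⟩ | ⟨w', hw', h⟩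
    · obtain ⟨x, hx, hxz⟩ := hVx z' hz'
      left
      have : Ψ (x, 0) = ι u := by simp [hΨψ, ψ, hγ₂0, hxz, h]
      rw [← this, Ψ.left_inv hx]
    · obtain ⟨y, hy, hyw⟩ := hWx w' hw'
      right
      have : Ψ (0, y) = ι u := by simp [hΨψ, ψ, hγ₁0, hyw, h]
      rw [← this, Ψ.left_inv hy]
  refine ⟨U, f, hUo, ⟨hp₀, mem_interior_iff_mem_nhds.2 hN⟩, hf.mono Set.inter_subset_left, ?_, ?_⟩
  · intro u hu
    have hιu : ι u ∈ Ψ.target := hUt hu.1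
    have hΦc : ContinuousAt (fun u' => Ψ.symm (ι u')) u :=
      (Ψ.continuousAt_symm hιu).comp hsm.continuous.continuousAt
    have hUev : ∀ᶠ u' in 𝓝 u, ι u' ∈ U :=
      hsm.continuous.continuousAt.eventually (hUo.mem_nhds hu)
    have hΦd : DifferentiableAt ℝ Ψ.symm (ι u) :=
      (hΨs.hasFDerivAt_fderiv Ψ.open_target hιu).differentiableAt
    have hright : ∀ a, fderiv ℝ Ψ (Ψ.symm (ι u)) (fderiv ℝ Ψ.symm (ι u) a) = a := fun a => by
      have := fderiv_comp_fderiv_symm hΨ hΨs (Ψ.map_target hιu)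
      rw [Ψ.right_inv hιu] at this
      exact congrArg (fun l => l a) this
    ext v
    change dc f (ι u) (pushforward ι u v) = 0
    rw [dc_apply, ← hJa, neg_eq_zero]
    -- At `p` itself `df = 0`. Elsewhere one coordinate is nonzero, and stays so near `u`; by
    -- `hbranch` the other vanishes identically near `u`, so `ι_*v` is tangent to that single
    -- branch.
    by_cases hx : (Ψ.symm (ι u)).1 = 0
    · by_cases hy : (Ψ.symm (ι u)).2 = 0
      · have : ι u = p := by
          rw [← Ψ.right_inv hιu, show Ψ.symm (ι u) = 0 from Prod.ext hx hy, hΨ0]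
        rw [this, hfp]
        rfl
      · have hev : ∀ᶠ u' in 𝓝 u, ContinuousLinearMap.fst ℝ E E (Ψ.symm (ι u')) = 0 := by
          filter_upwards [hUev, hΦc.snd.eventually_ne hy] with u' h1 h2
          exact (hbranch u' h1).resolve_left h2
        have h1 := map_fderiv_symm_pushforward_eq_zero hsm hΦd _ hev v
        rw [← hright (pushforward ι u v),
          show fderiv ℝ Ψ.symm (ι u) (pushforward ι u v) = (0, _) from Prod.ext h1 rfl]
        exact hf₂ _ hu.1 hx _
    · have hev : ∀ᶠ u' in 𝓝 u, ContinuousLinearMap.snd ℝ E E (Ψ.symm (ι u')) = 0 := by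
        filter_upwards [hUev, hΦc.fst.eventually_ne hx] with u' h1 h2
        exact (hbranch u' h1).resolve_right h2
      have h1 := map_fderiv_symm_pushforward_eq_zero hsm hΦd _ hev v
      rw [← hright (pushforward ι u v),
        show fderiv ℝ Ψ.symm (ι u) (pushforward ι u v) = (_, 0) from Prod.ext rfl h1]
      exact hf₁ _ hu.1 ((hbranch u hu).resolve_right hx) _
  · intro ζ hζ v hv
    have hd : DifferentiableAt ℝ (fderiv ℝ f) ζ :=
      ((hf.fderiv_of_isOpen hU₀ (m := ∞) (by simp)).hasFDerivAt_fderiv hU₀ hζ.1).differentiableAt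
    rw [ddc_apply_I_smul hd]
    exact add_pos (hHess ζ hζ.1 v hv)
      (hHess ζ hζ.1 _ (smul_ne_zero Complex.I_ne_zero hv))
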